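/- Identify the state space of two qubits with $\mathbf C^4=\mathbf C^2\otimes\mathbf C^2$, with computational basis $|ij\rangle$, $i,j\in\{0,1\}$. Let $R_x(\theta)=e^{i\sigma_x\theta/2}$ and $R_z(\theta)=e^{i\sigma_z\theta/2}$ for $\theta\in\mathbf R$, where $\sigma_x,\sigma_z$ are the Pauli matrices, and let $\mathrm{CNOT}$ be the gate $|i,j\rangle\mapsto|i,i\oplus j\rangle$, controlled on the first qubit. Let $\mathbf C^4=\bigoplus_k E_k$ be any orthogonal decomposition into subspaces each of which is spanned by computational basis vectors. Then the two-qubit circuit in which one applies, in this order in time, $a\otimes b$, $\mathrm{CNOT}$, $R_x(\alpha)\otimes R_z(\beta)$, $\mathrm{CNOT}$, $c\otimes d$, with placeholders $a,b,c,d\in SU(2)$ and $\alpha,\beta\in\mathbf R$, is universal up to the measurement don't-care of this decomposition. That is, for every $u\in U(4)$ there are $a,b,c,d\in SU(2)$, $\alpha,\beta,\theta\in\mathbf R$ and an operator $v\in U(4)$ with $vE_k\subseteq E_k$ for every $k$, such that $$(c\otimes d)\cdot\mathrm{CNOT}\cdot(R_x(\alpha)\otimes R_z(\beta))\cdot\mathrm{CNOT}\cdot(a\otimes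 b)=e^{i\theta}\,v\,u .$$ -/

import Mathlib

open scoped Kronecker

noncomputable section

namespace TwoQubit

/-- Labels of the computational basis of two qubits: `(i, j)` stands for `|ij⟩`, where `i` is the
value of the top (higher order) qubit and `j` that of the bottom (lower order) qubit. -/
abbrev Idx : Type := Fin 2 × Fin 2

/-- The state space `ℂ² ⊗ ℂ² = ℂ⁴` with its standard inner product. -/
abbrev StateSpace : Type := EuclideanSpace ℂ Idx

/-- Two-qubit operators, as matrices in the computational basis. -/
abbrev Op : Type := Matrix Idx Idx ℂ

/-- The computational basis vector `|ij⟩`. -/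
def ket (p : Idx) : StateSpace := EuclideanSpace.single p 1

/-- The Pauli matrix `σ_x`. -/
def sigmaX : Matrix (Fin 2) (Fin 2) ℂ := !![0, 1; 1, 0]

/-- The Pauli matrix `σ_z`. -/
def sigmaZ : Matrix (Fin 2) (Fin 2) ℂ := !![1, 0; 0, -1]

/-- The one-parameter gate `R_x(θ) = exp (i σ_x θ / 2)`. -/
def Rx (θ : ℝ) : Matrix (Fin 2) (Fin 2) ℂ :=
  NormedSpace.exp ((Complex.I * (θ / 2 : ℂ)) • sigmaX)

/-- The one-parameter gate `R_z(θ) = exp (i σ_z θ / 2)`. -/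
def Rz (θ : ℝ) : Matrix (Fin 2) (Fin 2) ℂ :=
  NormedSpace.exp ((Complex.I * (θ / 2 : ℂ)) • sigmaZ)

/-- The `CNOT` gate controlled on the top qubit and acting on the bottom one:
`|ij⟩ ↦ |i, i + j mod 2⟩`. -/
def CNOT : Op := Matrix.of fun p q => if p = (q.1, q.1 + q.2) then 1 else 0

/-- A setting of the placeholders of the circuit: four gates from `SU(2)` and two angles. -/
structure Setting where
  a : Matrix.specialUnitaryGroup (Fin 2) ℂ
  b : Matrix.specialUnitaryGroup (Fin 2) ℂ
  c : Matrix.specialUnitaryGroup (Fin 2) ℂ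
  d : Matrix.specialUnitaryGroup (Fin 2) ℂ
  α : ℝ
  β : ℝ

/-- The operator computed by the circuit
```
  top:     --a--●--R_x--●--c--
                |       |
  bottom:  --b--⊕--R_z--⊕--d--
```
read from left to right in time, so that the gates at the left act first. -/
def twoCnotCircuit (s : Setting) : Op :=
  ((s.c : Matrix (Fin 2) (Fin 2) ℂ) ⊗ₖ (s.d : Matrix (Fin 2) (Fin 2) ℂ)) * CNOT *
    (Rx s.α ⊗ₖ Rz s.β) * CNOT *
      ((s.a : Matrix (Fin 2) (Fin 2) ℂ) ⊗ₖ (s.b : Matrix (Fin 2) (Fin 2) ℂ))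

/-- `E` is an orthogonal decomposition of the state space each of whose subspaces is spanned by
computational basis vectors. -/
structure IsCBDecomposition {ι : Type*} (E : ι → Submodule ℂ StateSpace) : Prop where
  orthogonal : Pairwise fun i j => E i ⟂ E j
  iSup_eq_top : ⨆ i, E i = ⊤
  spanned : ∀ i, ∃ S : Set Idx, E i = Submodule.span ℂ (ket '' S)

/-- The operator `v` maps each of the subspaces `E i` into itself. -/
def Preserves {ι : Type*} (E : ι → Submodule ℂ StateSpace) (v : Op) : Prop :=
  ∀ i, ∀ x ∈ E i, Matrix.toEuclideanLin v x ∈ E i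

/-- `m` and `w` agree up to global phase. -/
def EqUpToPhase (m w : Op) : Prop :=
  ∃ θ : ℝ, m = Complex.exp (θ * Complex.I) • w

/-- The circuit with placeholders `C` is universal up to the measurement don't-care of the
decomposition `E`: for every `u ∈ U(4)`, some setting of the placeholders gives a circuit that
simulates, up to global phase, an operator `w = v u` with `v ∈ U(4)` preserving every `E i`. -/
def IsUniversalUpTo {P : Type*} (C : P → Op) {ι : Type*}
    (E : ι → Submodule ℂ StateSpace) : Prop :=
  ∀ u ∈ Matrix.unitaryGroup Idx ℂ, ∃ s : P, ∃ w : Op, EqUpToPhase (C s) w ∧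
    ∃ v ∈ Matrix.unitaryGroup Idx ℂ, Preserves E v ∧ w = v * u

end TwoQubit

end

noncomputable section

namespace TwoQubit

open Matrix

/-! The don't-care is used only through the diagonal gates `parityPhase e`, which preserve every
span of computational basis vectors. It therefore suffices to reach `parityPhase e * u` up to phase
for some unit `e`.

In the magic basis, `SU(2) ⊗ SU(2)` becomes `SO(4)` (`isLocal_of_mem_specialOrthogonalGroup`), and
CNOT, `Rx α ⊗ Rz β`, CNOT becomes `diag(x, y, x⁻¹, y⁻¹)` with arbitrary unit `x`, `y`
(`magic_mul_diagonal`). So the circuit yields exactly the products `K D L` with `K`, `L` in `SO(4)`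
and `D` of this shape. For `V` in `SU(4)`, the eigenvalues of the symmetric unitary `Vᵀ V` are the
entries of `D²`. They form two inverse pairs once the trace of `Vᵀ V` is real
(`exists_perm_mul_eq_one`, `exists_canonical_decomposition`). This is a single real condition, and
the single parameter `e` can be tuned to meet it (`exists_phase_trace_real`). -/

/-- Columns are the vectorisations of `1, iσ_z, iσ_y, iσ_x`. -/
def magic : Matrix Idx (Fin 4) ℂ :=
  Matrix.of fun p => ![(1 : Matrix (Fin 2) (Fin 2) ℂ) p.1 p.2,
    !![Complex.I, 0; 0, -Complex.I] p.1 p.2, !![0, 1; -1, 0] p.1 p.2,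
    !![0, Complex.I; Complex.I, 0] p.1 p.2]

theorem magic_mul_conjTranspose : magic * ((1 / 2 : ℂ) • magicᴴ) = 1 := by
  ext ⟨i, j⟩ ⟨k, l⟩
  fin_cases i <;> fin_cases j <;> fin_cases k <;> fin_cases l <;>
    simp [magic, Matrix.mul_apply, Fin.sum_univ_four, Matrix.one_apply] <;>
    ring_nf <;> norm_num

theorem conjTranspose_mul_magic : ((1 / 2 : ℂ) • magicᴴ) * magic = 1 := by
  ext i j
  fin_cases i <;> fin_cases j <;>
    simp [magic, Matrix.mul_apply, Fintype.sum_prod_type, Matrix.one_apply] <;>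
    ring_nf <;> norm_num

/-! ### Local gates and `SO(4)`, through quaternions. -/

/-- The real matrix `K` acts, in the magic basis, as a tensor product of two gates. -/
def IsLocal (K : Matrix (Fin 4) (Fin 4) ℝ) : Prop :=
  ∃ c d : Matrix.specialUnitaryGroup (Fin 2) ℂ,
    magic * K.map Complex.ofRealHom =
      ((c : Matrix (Fin 2) (Fin 2) ℂ) ⊗ₖ (d : Matrix (Fin 2) (Fin 2) ℂ)) * magic

theorem IsLocal.mul {K L : Matrix (Fin 4) (Fin 4) ℝ} (hK : IsLocal K) (hL : IsLocal L) :
    IsLocal (K * L) := by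
  obtain ⟨c, d, h⟩ := hK
  obtain ⟨c', d', h'⟩ := hL
  refine ⟨c * c', d * d', ?_⟩
  rw [Matrix.map_mul, ← Matrix.mul_assoc, h, Matrix.mul_assoc, h', ← Matrix.mul_assoc]
  simp [Matrix.mul_kronecker_mul]

/-- The matrix of left multiplication by a quaternion. -/
def quatLeft (a b c d : ℝ) : Matrix (Fin 4) (Fin 4) ℝ :=
  !![a, -b, -c, -d; b, a, -d, c; c, d, a, -b; d, -c, b, a]

/-- The matrix of right multiplication by a quaternion. -/
def quatRight (a b c d : ℝ) : Matrix (Fin 4) (Fin 4) ℝ :=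
  !![a, -b, -c, -d; b, a, d, -c; c, -d, a, b; d, c, -b, a]

/-- The `2 × 2` complex matrix of a quaternion. -/
def quatMatrix (a b c d : ℝ) : Matrix (Fin 2) (Fin 2) ℂ :=
  !![a + b * Complex.I, c + d * Complex.I; -c + d * Complex.I, a - b * Complex.I]

theorem quatMatrix_mem {a b c d : ℝ} (h : a ^ 2 + b ^ 2 + c ^ 2 + d ^ 2 = 1) :
    quatMatrix a b c d ∈ Matrix.specialUnitaryGroup (Fin 2) ℂ := by
  have h' : (a : ℂ) ^ 2 + b ^ 2 + c ^ 2 + d ^ 2 = 1 := by exact_mod_cast h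
  have hI := Complex.I_sq
  rw [Matrix.mem_specialUnitaryGroup_iff, Matrix.mem_unitaryGroup_iff]
  constructor
  · ext i j
    fin_cases i <;> fin_cases j <;>
      simp [quatMatrix, Matrix.mul_apply, Matrix.star_eq_conjTranspose] <;>
      first | (ring; done) | linear_combination h' - (b ^ 2 + d ^ 2 : ℂ) * hI
  · simp only [quatMatrix, Matrix.det_fin_two_of]
    linear_combination h' - (b ^ 2 + d ^ 2 : ℂ) * hI

/-- `magic` vectorises the matrix of a quaternion, and `(g ⊗ h) vec M = vec (g M hᵀ)`. Left
multiplication is thus a gate on the first qubit alone. -/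
theorem isLocal_quatLeft {a b c d : ℝ} (h : a ^ 2 + b ^ 2 + c ^ 2 + d ^ 2 = 1) :
    IsLocal (quatLeft a b c d) := by
  refine ⟨⟨_, quatMatrix_mem h⟩, 1, ?_⟩
  ext ⟨i, j⟩ k
  fin_cases i <;> fin_cases j <;> fin_cases k <;>
    simp [magic, quatLeft, quatMatrix, Matrix.mul_apply, Fin.sum_univ_four,
      Fintype.sum_prod_type] <;> ring_nf <;> simp

theorem isLocal_quatRight {a b c d : ℝ} (h : a ^ 2 + b ^ 2 + c ^ 2 + d ^ 2 = 1) :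
    IsLocal (quatRight a b c d) := by
  -- The second factor acts through its transpose, and transposing `quatMatrix` changes the sign of
  -- `c`.
  have h' : a ^ 2 + b ^ 2 + (-c) ^ 2 + d ^ 2 = 1 := by linear_combination h
  refine ⟨1, ⟨_, quatMatrix_mem h'⟩, ?_⟩
  ext ⟨i, j⟩ k
  fin_cases i <;> fin_cases j <;> fin_cases k <;>
    simp [magic, quatRight, quatMatrix, Matrix.mul_apply, Fin.sum_univ_four,
      Fintype.sum_prod_type] <;> ring_nf <;> simp

theorem quatLeft_conj_mul {a b c d : ℝ} (h : a ^ 2 + b ^ 2 + c ^ 2 + d ^ 2 = 1) :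
    quatLeft a (-b) (-c) (-d) * quatLeft a b c d = 1 := by
  ext i j
  fin_cases i <;> fin_cases j <;>
    simp [quatLeft, Matrix.mul_apply, Fin.sum_univ_four] <;>
    first | (ring; done) | linear_combination h

theorem quatRight_conj_mul {a b c d : ℝ} (h : a ^ 2 + b ^ 2 + c ^ 2 + d ^ 2 = 1) :
    quatRight a (-b) (-c) (-d) * quatRight a b c d = 1 := by
  ext i j
  fin_cases i <;> fin_cases j <;>
    simp [quatRight, Matrix.mul_apply, Fin.sum_univ_four] <;>
    first | (ring; done) | linear_combination h

theorem det_quatLeft {a b c d : ℝ} (h : a ^ 2 + b ^ 2 + c ^ 2 + d ^ 2 = 1) :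
    (quatLeft a b c d).det = 1 := by
  have : (quatLeft a b c d).det = (a ^ 2 + b ^ 2 + c ^ 2 + d ^ 2) ^ 2 := by
    simp [quatLeft, Matrix.det_succ_row_zero, Fin.sum_univ_succ, Fin.succAbove]
    ring
  rw [this, h, one_pow]

theorem det_quatRight {a b c d : ℝ} (h : a ^ 2 + b ^ 2 + c ^ 2 + d ^ 2 = 1) :
    (quatRight a b c d).det = 1 := by
  have : (quatRight a b c d).det = (a ^ 2 + b ^ 2 + c ^ 2 + d ^ 2) ^ 2 := by
    simp [quatRight, Matrix.det_succ_row_zero, Fin.sum_univ_succ, Fin.succAbove]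
    ring
  rw [this, h, one_pow]

theorem transpose_quatLeft (a b c d : ℝ) :
    (quatLeft a b c d)ᵀ = quatLeft a (-b) (-c) (-d) := by
  ext i j
  fin_cases i <;> fin_cases j <;> simp [quatLeft]

theorem transpose_quatRight (a b c d : ℝ) :
    (quatRight a b c d)ᵀ = quatRight a (-b) (-c) (-d) := by
  ext i j
  fin_cases i <;> fin_cases j <;> simp [quatRight]

theorem quatLeft_mem {a b c d : ℝ} (h : a ^ 2 + b ^ 2 + c ^ 2 + d ^ 2 = 1) :
    quatLeft a b c d ∈ Matrix.specialOrthogonalGroup (Fin 4) ℝ := by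
  rw [Matrix.mem_specialOrthogonalGroup_iff, Matrix.mem_orthogonalGroup_iff']
  exact ⟨by rw [transpose_quatLeft, quatLeft_conj_mul h], det_quatLeft h⟩

theorem quatRight_mem {a b c d : ℝ} (h : a ^ 2 + b ^ 2 + c ^ 2 + d ^ 2 = 1) :
    quatRight a b c d ∈ Matrix.specialOrthogonalGroup (Fin 4) ℝ := by
  rw [Matrix.mem_specialOrthogonalGroup_iff, Matrix.mem_orthogonalGroup_iff']
  exact ⟨by rw [transpose_quatRight, quatRight_conj_mul h], det_quatRight h⟩

theorem sum_mul_of_mem {K : Matrix (Fin 4) (Fin 4) ℝ}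
    (hK : K ∈ Matrix.specialOrthogonalGroup (Fin 4) ℝ) (i j : Fin 4) :
    K 0 i * K 0 j + K 1 i * K 1 j + K 2 i * K 2 j + K 3 i * K 3 j =
      (1 : Matrix (Fin 4) (Fin 4) ℝ) i j := by
  have h := Matrix.mem_orthogonalGroup_iff' _ _ |>.1 (Matrix.mem_specialOrthogonalGroup_iff.1 hK).1
  rw [← h]
  simp [Matrix.mul_apply, Fin.sum_univ_four]

/-- A rotation of `ℝ⁴` fixing the first two basis vectors is local. -/
theorem isLocal_of_fixes_two {K : Matrix (Fin 4) (Fin 4) ℝ}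
    (hK : K ∈ Matrix.specialOrthogonalGroup (Fin 4) ℝ)
    (h0 : ∀ i, K i 0 = (1 : Matrix (Fin 4) (Fin 4) ℝ) i 0)
    (h1 : ∀ i, K i 1 = (1 : Matrix (Fin 4) (Fin 4) ℝ) i 1) : IsLocal K := by
  have o := sum_mul_of_mem hK
  have hdet := (Matrix.mem_specialOrthogonalGroup_iff.1 hK).2
  have e02 := o 0 2
  have e03 := o 0 3
  have e12 := o 1 2
  have e13 := o 1 3
  have e22 := o 2 2
  have e23 := o 2 3
  simp only [h0, h1] at e02 e03 e12 e13
  simp [Matrix.one_apply] at e02 e03 e12 e13 e22 e23 h0 h1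
  simp [e02, e03, e12, e13] at e22 e23
  simp [Matrix.det_succ_row_zero, Fin.sum_univ_succ, Fin.succAbove, e12, e13, h0, h1]
    at hdet
  generalize hx2 : K 2 2 = x at *
  generalize hz2 : K 3 2 = z at *
  have hw : K 3 3 = x := by linear_combination (-K 3 3) * e22 + x * hdet + z * e23
  have hy : K 2 3 = -z := by linear_combination (-K 2 3) * e22 + x * e23 - z * hdet
  -- `K` is the rotation by `s` of the `j, k` plane, that is `v ↦ p v p⁻¹` with `p = cos (s/2) + i
  -- sin (s/2)`.
  obtain ⟨s, hs⟩ := (Complex.norm_eq_one_iff (x + z * Complex.I)).1 (by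
    rw [Complex.norm_add_mul_I, Real.sqrt_eq_one]; linear_combination e22)
  have hx : Real.cos s = x := by
    have := congrArg Complex.re hs
    rwa [Complex.exp_ofReal_mul_I_re, Complex.add_re, Complex.ofReal_re,
      Complex.re_ofReal_mul, Complex.I_re, mul_zero, add_zero] at this
  have hz : Real.sin s = z := by
    have := congrArg Complex.im hs
    rwa [Complex.exp_ofReal_mul_I_im, Complex.add_im, Complex.ofReal_im,
      Complex.im_ofReal_mul, Complex.I_im, mul_one, zero_add] at this
  have hx' : x = Real.cos (s / 2) ^ 2 - Real.sin (s / 2) ^ 2 := by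
    rw [← Real.cos_two_mul', mul_div_cancel₀ _ two_ne_zero, hx]
  have hz' : z = 2 * Real.sin (s / 2) * Real.cos (s / 2) := by
    rw [← Real.sin_two_mul, mul_div_cancel₀ _ two_ne_zero, hz]
  have hcs := Real.cos_sq_add_sin_sq (s / 2)
  set a := Real.cos (s / 2)
  set b := Real.sin (s / 2)
  have hl : a ^ 2 + b ^ 2 + 0 ^ 2 + 0 ^ 2 = 1 := by linear_combination hcs
  have hr : a ^ 2 + (-b) ^ 2 + 0 ^ 2 + 0 ^ 2 = 1 := by linear_combination hcs
  convert! (isLocal_quatLeft hl).mul (isLocal_quatRight hr) using 1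
  ext i j
  fin_cases i <;> fin_cases j <;>
    simp [quatLeft, quatRight, Matrix.mul_apply, Fin.sum_univ_four, h0, h1, e02, e03, e12, e13,
      hw, hy, hx2, hz2] <;>
      first
        | (ring; done)
        | linear_combination -hcs
        | linear_combination hx'
        | linear_combination hz'
        | linear_combination -hz'

/-- Unit imaginary quaternions are conjugate to the first imaginary unit. -/
theorem exists_conj_quaternion {x y z : ℝ} (h : x ^ 2 + y ^ 2 + z ^ 2 = 1) :
    ∃ a c d : ℝ, a ^ 2 + c ^ 2 + d ^ 2 = 1 ∧ x = 2 * a ^ 2 - 1 ∧ y = -(2 * a * d) ∧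
      z = 2 * a * c := by
  have hx : -1 ≤ x := by nlinarith [sq_nonneg y, sq_nonneg z]
  -- The equations express `x i + y j + z k = p⁻¹ i p` for `p = a + c j + d k`, so `a² = (1 + x) /
  -- 2`. Solving for `c` and `d` divides by `a`; when `x = -1`, `p = j` works.
  rcases hx.eq_or_lt with rfl | hx
  · have hy : y = 0 := by nlinarith [sq_nonneg y, sq_nonneg z]
    have hz : z = 0 := by nlinarith [sq_nonneg y, sq_nonneg z]
    exact ⟨0, 1, 0, by norm_num, by norm_num, by simp [hy], by simp [hz]⟩
  · set a := Real.sqrt ((1 + x) / 2)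
    have ha : a ^ 2 = (1 + x) / 2 := Real.sq_sqrt (by linarith)
    have ha0 : a ≠ 0 := (Real.sqrt_pos.2 (by linarith)).ne'
    refine ⟨a, z / (2 * a), -y / (2 * a), ?_, by linear_combination -2 * ha, by field_simp,
      by field_simp⟩
    have hx1 : 1 + x ≠ 0 := by linarith
    rw [div_pow, div_pow, mul_pow, ha]
    field_simp
    linear_combination h

/-- A rotation of `ℝ⁴` fixing the first basis vector is local. -/
theorem isLocal_of_fixes_one {K : Matrix (Fin 4) (Fin 4) ℝ}
    (hK : K ∈ Matrix.specialOrthogonalGroup (Fin 4) ℝ)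
    (h0 : ∀ i, K i 0 = (1 : Matrix (Fin 4) (Fin 4) ℝ) i 0) : IsLocal K := by
  have o := sum_mul_of_mem hK
  have e01 := o 0 1
  have e11 := o 1 1
  simp only [h0] at e01
  simp [Matrix.one_apply] at e01 e11 h0
  obtain ⟨a, c, d, hn, hx, hy, hz⟩ := exists_conj_quaternion
    (x := K 1 1) (y := K 2 1) (z := K 3 1) (by rw [e01] at e11; linear_combination e11)
  have h₁ : a ^ 2 + 0 ^ 2 + c ^ 2 + d ^ 2 = 1 := by linear_combination hn
  have h₂ : a ^ 2 + (-0) ^ 2 + (-c) ^ 2 + (-d) ^ 2 = 1 := by linear_combination hn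
  -- Conjugation by `p = a + c j + d k` fixes `1` and carries the second column of `K` back to `i`.
  -- Composed with `K`, it fixes the first two basis vectors.
  have hinv : quatRight a 0 c d * quatLeft a (-0) (-c) (-d) *
      (quatLeft a 0 c d * quatRight a (-0) (-c) (-d) * K) = K := by
    rw [Matrix.mul_assoc, ← Matrix.mul_assoc (quatLeft a (-0) (-c) (-d)),
      ← Matrix.mul_assoc (quatLeft a (-0) (-c) (-d)), quatLeft_conj_mul h₁, Matrix.one_mul,
      ← Matrix.mul_assoc, mul_eq_one_comm.1 (quatRight_conj_mul h₁), Matrix.one_mul]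
  rw [← hinv]
  refine ((isLocal_quatRight h₁).mul (isLocal_quatLeft h₂)).mul (isLocal_of_fixes_two
    (mul_mem (mul_mem (quatLeft_mem h₁) (quatRight_mem h₂)) hK) ?_ ?_)
  · intro i
    fin_cases i <;>
      simp [quatLeft, quatRight, Matrix.mul_apply, Matrix.one_apply, h0] <;>
      first | (ring; done) | linear_combination hn
  · intro i
    fin_cases i <;>
      simp [quatLeft, quatRight, Matrix.mul_apply, Matrix.one_apply, Fin.sum_univ_four, e01, hx, hy, hz] <;>
      first
        | (ring; done)
        | linear_combination (2 * a ^ 2 + 1) * hn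
        | linear_combination (2 * a * c) * hn
        | linear_combination (-2 * a * c) * hn
        | linear_combination (2 * a * d) * hn

/-- `SO(4)` is, in the magic basis, the image of `SU(2) × SU(2)`. -/
theorem isLocal_of_mem_specialOrthogonalGroup {K : Matrix (Fin 4) (Fin 4) ℝ}
    (hK : K ∈ Matrix.specialOrthogonalGroup (Fin 4) ℝ) : IsLocal K := by
  have e00 := sum_mul_of_mem hK 0 0
  simp only [Matrix.one_apply_eq] at e00
  have h₁ : K 0 0 ^ 2 + K 1 0 ^ 2 + K 2 0 ^ 2 + K 3 0 ^ 2 = 1 := by linear_combination e00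
  have h₂ : K 0 0 ^ 2 + (-K 1 0) ^ 2 + (-K 2 0) ^ 2 + (-K 3 0) ^ 2 = 1 := by
    linear_combination e00
  -- Left multiplication by the conjugate of the first column, a unit quaternion, sends that column
  -- to `1`.
  rw [← Matrix.one_mul K, ← mul_eq_one_comm.1 (quatLeft_conj_mul h₁), Matrix.mul_assoc]
  refine (isLocal_quatLeft h₁).mul (isLocal_of_fixes_one (mul_mem (quatLeft_mem h₂) hK) ?_)
  intro i
  fin_cases i <;> simp [quatLeft, Matrix.mul_apply, Matrix.one_apply, Fin.sum_univ_four] <;>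
    first | (ring; done) | linear_combination e00

/-! ### Real diagonalisation of symmetric unitary matrices. -/

/-- Commuting symmetric operators have a common orthonormal eigenbasis. -/
theorem exists_orthonormalBasis_of_commute {F : Type*} [NormedAddCommGroup F]
    [InnerProductSpace ℝ F] [FiniteDimensional ℝ F] {n : ℕ} (hn : Module.finrank ℝ F = n)
    {A B : F →ₗ[ℝ] F} (hA : A.IsSymmetric) (hB : B.IsSymmetric) (hc : Commute A B) :
    ∃ (b : OrthonormalBasis (Fin n) ℝ F) (r s : Fin n → ℝ),
      ∀ j, A (b j) = r j • b j ∧ B (b j) = s j • b j := by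
  let V : ℝ × ℝ → Submodule ℝ F := fun i =>
    Module.End.eigenspace A i.2 ⊓ Module.End.eigenspace B i.1
  have hint : DirectSum.IsInternal V := hA.directSum_isInternal_of_commute hB hc
  -- Discarding the zero joint eigenspaces leaves a finite index type.
  have hint' : DirectSum.IsInternal fun i : {i // V i ≠ ⊥} => V i :=
    DirectSum.isInternal_ne_bot_iff.2 hint
  have horth : OrthogonalFamily ℝ (fun i : {i // V i ≠ ⊥} => V i) fun i => (V i).subtypeₗᵢ :=
    (hA.orthogonalFamily_eigenspace_inf_eigenspace hB).comp (γ := {i // V i ≠ ⊥})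
      Subtype.val_injective
  have : Fintype {i // V i ≠ ⊥} :=
    hint.submodule_iSupIndep.fintypeNeBotOfFiniteDimensional
  exact ⟨hint'.subordinateOrthonormalBasis hn horth,
    fun j => (hint'.subordinateOrthonormalBasisIndex hn j horth).1.2,
    fun j => (hint'.subordinateOrthonormalBasisIndex hn j horth).1.1, fun j =>
    have h := hint'.subordinateOrthonormalBasis_subordinate hn j horth
    ⟨Module.End.mem_eigenspace_iff.1 h.1, Module.End.mem_eigenspace_iff.1 h.2⟩⟩

/-- Symmetric unitary matrices are diagonalisable by real orthogonal matrices. -/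
theorem exists_orthogonal_diagonalization {n : ℕ} {P : Matrix (Fin n) (Fin n) ℂ}
    (hs : Pᵀ = P) (hu : P ∈ Matrix.unitaryGroup (Fin n) ℂ) :
    ∃ O ∈ Matrix.orthogonalGroup (Fin n) ℝ, ∃ z : Fin n → ℂ,
      P * O.map Complex.ofRealHom = O.map Complex.ofRealHom * diagonal z := by
  set A : Matrix (Fin n) (Fin n) ℝ := P.map Complex.re with hA
  set B : Matrix (Fin n) (Fin n) ℝ := P.map Complex.im with hB
  have hsymm : ∀ i j, P i j = P j i := fun i j => congrFun (congrFun hs j) i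
  -- Since `P = A + iB` is symmetric, `P* P = A² + B² + i(AB - BA)`; its imaginary part vanishes.
  have hcomm : A * B = B * A := by
    ext i j
    have h := congrFun (congrFun (Matrix.mem_unitaryGroup_iff'.1 hu) i) j
    have h' := congrArg Complex.im h
    have h1 : ((1 : Matrix (Fin n) (Fin n) ℂ) i j).im = 0 := by
      rw [Matrix.one_apply]; split_ifs <;> simp
    rw [h1, Matrix.mul_apply, Complex.im_sum] at h'
    rw [← sub_eq_zero, Matrix.mul_apply, Matrix.mul_apply, ← Finset.sum_sub_distrib, ← h']
    refine Finset.sum_congr rfl fun k _ => ?_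
    simp [hA, hB, hsymm k i]
    ring
  have hAs : (Matrix.toEuclideanLin A).IsSymmetric := by
    rw [Matrix.isSymmetric_toEuclideanLin_iff]
    ext i j
    simp [hA, hsymm i j]
  have hBs : (Matrix.toEuclideanLin B).IsSymmetric := by
    rw [Matrix.isSymmetric_toEuclideanLin_iff]
    ext i j
    simp [hB, hsymm i j]
  have hc : Commute (Matrix.toEuclideanLin A) (Matrix.toEuclideanLin B) := by
    ext x i
    simp [Matrix.toLpLin_apply, Matrix.mulVec_mulVec, hcomm]
  obtain ⟨b, r, t, hb⟩ := exists_orthonormalBasis_of_commute finrank_euclideanSpace_fin hAs hBs hc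
  have hbA : ∀ i j, ∑ k, A i k * b j k = r j * b j i := fun i j => by
    have := congrArg (fun x : EuclideanSpace ℝ (Fin n) => x i) (hb j).1
    simpa [Matrix.toLpLin_apply, Matrix.mulVec, dotProduct] using this
  have hbB : ∀ i j, ∑ k, B i k * b j k = t j * b j i := fun i j => by
    have := congrArg (fun x : EuclideanSpace ℝ (Fin n) => x i) (hb j).2
    simpa [Matrix.toLpLin_apply, Matrix.mulVec, dotProduct] using this
  refine ⟨Matrix.of fun i j => b j i, ?_, fun j => r j + t j * Complex.I, ?_⟩
  · rw [Matrix.mem_orthogonalGroup_iff']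
    ext i j
    have := orthonormal_iff_ite.1 b.orthonormal j i
    simp only [PiLp.inner_apply, RCLike.inner_apply, conj_trivial] at this
    simp [Matrix.mul_apply, Matrix.one_apply, this, eq_comm]
  · ext i j
    rw [Matrix.mul_diagonal, Matrix.mul_apply]
    apply Complex.ext
    · simpa [hA, mul_comm] using hbA i j
    · simpa [hB, mul_comm] using hbB i j

/-! ### The canonical decomposition in `SU(4)`. -/

/-- Four unit complex numbers with product `1` and real sum form two pairs of inverses. -/
theorem exists_perm_mul_eq_one {z : Fin 4 → ℂ} (hz : ∀ i, ‖z i‖ = 1) (hp : ∏ i, z i = 1)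
    (hr : (∑ i, z i).im = 0) :
    ∃ σ : Equiv.Perm (Fin 4), z (σ 0) * z (σ 2) = 1 ∧ z (σ 1) * z (σ 3) = 1 := by
  have hc : ∀ i, z i * (starRingEnd ℂ) (z i) = 1 := fun i => by
    rw [Complex.mul_conj']; simp [hz i]
  have hs := Complex.conj_eq_iff_im.2 hr
  rw [map_sum, Fin.sum_univ_four, Fin.sum_univ_four] at hs
  rw [Fin.prod_univ_four] at hp
  have h0 : (starRingEnd ℂ) (z 0) = z 1 * z 2 * z 3 := by
    linear_combination (-(starRingEnd ℂ) (z 0)) * hp + (z 1 * z 2 * z 3) * hc 0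
  have h1 : (starRingEnd ℂ) (z 1) = z 0 * z 2 * z 3 := by
    linear_combination (-(starRingEnd ℂ) (z 1)) * hp + (z 0 * z 2 * z 3) * hc 1
  have h2 : (starRingEnd ℂ) (z 2) = z 0 * z 1 * z 3 := by
    linear_combination (-(starRingEnd ℂ) (z 2)) * hp + (z 0 * z 1 * z 3) * hc 2
  have h3 : (starRingEnd ℂ) (z 3) = z 0 * z 1 * z 2 := by
    linear_combination (-(starRingEnd ℂ) (z 3)) * hp + (z 0 * z 1 * z 2) * hc 3
  rw [h0, h1, h2, h3] at hs
  -- Conjugation turns the sum into the third elementary symmetric function, so `e₁ = e₃`. Given `e₄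
  -- = 1`, the product below equals `z₀ (e₃ - e₁)`. The permutation then puts the partner of `z 0`
  -- in position 2.
  have key : (1 - z 0 * z 1) * (1 - z 0 * z 2) * (1 - z 0 * z 3) = 0 := by
    linear_combination z 0 * hs - (z 0 ^ 2 + 1) * hp
  rcases mul_eq_zero.1 key with h | h
  · rcases mul_eq_zero.1 h with h | h
    · exact ⟨Equiv.swap 1 2, by
        simpa [Equiv.swap_apply_def] using (sub_eq_zero.1 h).symm, by
        simp only [Equiv.swap_apply_def]
        simp
        linear_combination hp + z 2 * z 3 * h⟩
    · exact ⟨1, by simpa using (sub_eq_zero.1 h).symm, by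
        simp
        linear_combination hp + z 1 * z 3 * h⟩
  · exact ⟨Equiv.swap 2 3, by
        simpa [Equiv.swap_apply_def] using (sub_eq_zero.1 h).symm, by
        simp only [Equiv.swap_apply_def]
        simp
        linear_combination hp + z 1 * z 2 * h⟩

/-- The columns of an orthogonal matrix can be permuted, and their signs adjusted, so as to
obtain determinant `1`. -/
theorem exists_specialOrthogonal_permuted_columns {O : Matrix (Fin 4) (Fin 4) ℝ}
    (hO : O ∈ Matrix.orthogonalGroup (Fin 4) ℝ) (σ : Equiv.Perm (Fin 4)) :
    ∃ O' ∈ Matrix.specialOrthogonalGroup (Fin 4) ℝ, ∃ ε : Fin 4 → ℝ,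
      ∀ i j, O' i j = O i (σ j) * ε j := by
  have hO' := (Matrix.mem_orthogonalGroup_iff' _ _).1 hO
  have hs : (O.submatrix id σ)ᵀ * O.submatrix id σ = 1 := by
    rw [Matrix.transpose_submatrix, ← Matrix.submatrix_mul _ _ σ id σ Function.bijective_id, hO',
      Matrix.submatrix_one_equiv]
  set d := (O.submatrix id σ).det
  have hd : d * d = 1 := by
    have := congrArg Matrix.det hs
    rwa [Matrix.det_mul, Matrix.det_transpose, Matrix.det_one] at this
  refine ⟨O.submatrix id σ * diagonal ![d, 1, 1, 1], ?_, ![d, 1, 1, 1], fun i j => by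
    rw [Matrix.mul_diagonal]; rfl⟩
  rw [Matrix.mem_specialOrthogonalGroup_iff, Matrix.mem_orthogonalGroup_iff']
  constructor
  · rw [Matrix.transpose_mul, Matrix.mul_assoc, ← Matrix.mul_assoc _ (O.submatrix id σ), hs,
      Matrix.one_mul, Matrix.diagonal_transpose, Matrix.diagonal_mul_diagonal,
      ← Matrix.diagonal_one]
    congr 1
    ext i
    fin_cases i <;> simp [hd]
  · rw [Matrix.det_mul, Matrix.det_diagonal, Fin.prod_univ_four]
    simpa using hd

theorem map_ofReal_mem_unitaryGroup {O : Matrix (Fin 4) (Fin 4) ℝ}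
    (hO : O ∈ Matrix.orthogonalGroup (Fin 4) ℝ) :
    O.map Complex.ofRealHom ∈ Matrix.unitaryGroup (Fin 4) ℂ := by
  have h := congrArg (fun K : Matrix (Fin 4) (Fin 4) ℝ => K.map Complex.ofRealHom)
    ((Matrix.mem_orthogonalGroup_iff' _ _).1 hO)
  rw [Matrix.mem_unitaryGroup_iff']
  convert! h using 1
  · rw [Matrix.map_mul]
    congr 1
    ext i j
    simp
  · simp

theorem star_map_ofReal (O : Matrix (Fin 4) (Fin 4) ℝ) :
    star (O.map Complex.ofRealHom) = (O.map Complex.ofRealHom)ᵀ := by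
  ext i j
  simp

/-- A matrix which is both unitary and complex orthogonal is real. -/
theorem exists_map_ofReal_eq {K : Matrix (Fin 4) (Fin 4) ℂ}
    (hK : K ∈ Matrix.specialUnitaryGroup (Fin 4) ℂ) (h : Kᵀ * K = 1) :
    ∃ L ∈ Matrix.specialOrthogonalGroup (Fin 4) ℝ, L.map Complex.ofRealHom = K := by
  obtain ⟨hu, hdet⟩ := Matrix.mem_specialUnitaryGroup_iff.1 hK
  -- Both are the inverse of `K`, so `K` equals its entrywise conjugate.
  have hst : star K = Kᵀ := by
    rw [← Matrix.mul_one (star K), ← mul_eq_one_comm.1 h, ← Matrix.mul_assoc,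
      Matrix.mem_unitaryGroup_iff'.1 hu, Matrix.one_mul]
  have hL : (K.map Complex.re).map Complex.ofRealHom = K := by
    ext i j
    have := congrFun (congrFun hst j) i
    exact Complex.conj_eq_iff_re.1 this
  refine ⟨K.map Complex.re, ?_, hL⟩
  have hinj : Function.Injective Complex.ofRealHom := Complex.ofReal_injective
  rw [Matrix.mem_specialOrthogonalGroup_iff, Matrix.mem_orthogonalGroup_iff']
  constructor
  · apply Matrix.map_injective hinj
    dsimp only
    rw [Matrix.map_mul, Matrix.transpose_map, hL, h]
    simp
  · apply hinj
    rw [RingHom.map_det, RingHom.mapMatrix_apply, hL, hdet, map_one]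

/-- The canonical decomposition of a matrix `V` in `SU(4)`, in the case that `Vᵀ V` has real
trace. -/
theorem exists_canonical_decomposition {V : Matrix (Fin 4) (Fin 4) ℂ}
    (hV : V ∈ Matrix.specialUnitaryGroup (Fin 4) ℂ) (ht : (Vᵀ * V).trace.im = 0) :
    ∃ K ∈ Matrix.specialOrthogonalGroup (Fin 4) ℝ, ∃ L ∈ Matrix.specialOrthogonalGroup (Fin 4) ℝ,
      ∃ η ξ : ℝ, V = K.map Complex.ofRealHom *
        diagonal ![Complex.exp (η * Complex.I), Complex.exp (ξ * Complex.I),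
          Complex.exp (-(η * Complex.I)), Complex.exp (-(ξ * Complex.I))] *
        L.map Complex.ofRealHom := by
  obtain ⟨hu, hdet⟩ := Matrix.mem_specialUnitaryGroup_iff.1 hV
  have hVt : Vᵀ ∈ Matrix.unitaryGroup (Fin 4) ℂ := by
    rw [Matrix.mem_unitaryGroup_iff]
    have := congrArg Matrix.transpose (Matrix.mem_unitaryGroup_iff'.1 hu)
    rwa [Matrix.transpose_mul, Matrix.transpose_one] at this
  obtain ⟨O, hO, z, hz⟩ := exists_orthogonal_diagonalization (P := Vᵀ * V)
    (by rw [Matrix.transpose_mul, Matrix.transpose_transpose]) (mul_mem hVt hu)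
  have hOu := map_ofReal_mem_unitaryGroup hO
  have hdiag : diagonal z = star (O.map Complex.ofRealHom) * (Vᵀ * V) *
      O.map Complex.ofRealHom := by
    rw [Matrix.mul_assoc, hz, ← Matrix.mul_assoc, Matrix.mem_unitaryGroup_iff'.1 hOu,
      Matrix.one_mul]
  have hzu : diagonal z ∈ Matrix.unitaryGroup (Fin 4) ℂ := by
    rw [hdiag]
    exact mul_mem (mul_mem (Unitary.star_mem hOu) (mul_mem hVt hu)) hOu
  have hz1 : ∀ i, ‖z i‖ = 1 := fun i => by
    have := congrFun (congrFun (Matrix.mem_unitaryGroup_iff.1 hzu) i) i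
    rw [Matrix.star_eq_conjTranspose, Matrix.diagonal_conjTranspose,
      Matrix.diagonal_mul_diagonal, Matrix.diagonal_apply_eq, Matrix.one_apply_eq] at this
    have h2 : ((‖z i‖ ^ 2 : ℝ) : ℂ) = 1 := by
      rw [← this, Complex.ofReal_pow, ← Complex.mul_conj']; rfl
    have h3 : ‖z i‖ ^ 2 = 1 := by exact_mod_cast h2
    exact (pow_eq_one_iff_of_nonneg (norm_nonneg _) two_ne_zero).1 h3
  have hzp : ∏ i, z i = 1 := by
    rw [← Matrix.det_diagonal, hdiag, Matrix.det_mul, Matrix.det_mul, mul_right_comm,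
      ← Matrix.det_mul, Matrix.mem_unitaryGroup_iff'.1 hOu, Matrix.det_mul, Matrix.det_transpose,
      hdet]
    simp
  have hzs : (∑ i, z i).im = 0 := by
    rw [← Matrix.trace_diagonal, hdiag, Matrix.trace_mul_comm, ← Matrix.mul_assoc,
      Matrix.mem_unitaryGroup_iff.1 hOu, Matrix.one_mul, ht]
  obtain ⟨σ, h02, h13⟩ := exists_perm_mul_eq_one hz1 hzp hzs
  obtain ⟨L, hL, ε, hε⟩ := exists_specialOrthogonal_permuted_columns hO σ
  obtain ⟨hLo, hLdet⟩ := Matrix.mem_specialOrthogonalGroup_iff.1 hL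
  have hPL : Vᵀ * V * L.map Complex.ofRealHom =
      L.map Complex.ofRealHom * diagonal (fun i => z (σ i)) := by
    ext i j
    have := congrFun (congrFun hz i) (σ j)
    rw [Matrix.mul_diagonal, Matrix.mul_apply] at this ⊢
    simp only [Matrix.map_apply, hε, map_mul] at this ⊢
    rw [mul_right_comm, ← this, Finset.sum_mul]
    exact Finset.sum_congr rfl fun k _ => by ring
  obtain ⟨θ, hθ⟩ := (Complex.norm_eq_one_iff (z (σ 0))).1 (hz1 _)
  obtain ⟨τ, hτ⟩ := (Complex.norm_eq_one_iff (z (σ 1))).1 (hz1 _)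
  -- Halving the angles gives a square root `D` of the eigenvalue matrix; inverse entries keep `det
  -- D = 1`.
  set η := θ / 2
  set ξ := τ / 2
  have hθ' : Complex.exp (η * Complex.I) * Complex.exp (η * Complex.I) = z (σ 0) := by
    rw [← Complex.exp_add, ← hθ]; congr 1; push_cast [η]; ring
  have hτ' : Complex.exp (ξ * Complex.I) * Complex.exp (ξ * Complex.I) = z (σ 1) := by
    rw [← Complex.exp_add, ← hτ]; congr 1; push_cast [ξ]; ring
  have hη : Complex.exp (η * Complex.I) * Complex.exp (-(η * Complex.I)) = 1 := by
    rw [← Complex.exp_add, add_neg_cancel, Complex.exp_zero]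
  have hξ : Complex.exp (ξ * Complex.I) * Complex.exp (-(ξ * Complex.I)) = 1 := by
    rw [← Complex.exp_add, add_neg_cancel, Complex.exp_zero]
  have hηc : (starRingEnd ℂ) (Complex.exp (-(η * Complex.I))) = Complex.exp (η * Complex.I) := by
    rw [← Complex.exp_conj]; simp
  have hξc : (starRingEnd ℂ) (Complex.exp (-(ξ * Complex.I))) = Complex.exp (ξ * Complex.I) := by
    rw [← Complex.exp_conj]; simp
  have hηc' : (starRingEnd ℂ) (Complex.exp (η * Complex.I)) = Complex.exp (-(η * Complex.I)) := by
    rw [← Complex.exp_conj]; simp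
  have hξc' : (starRingEnd ℂ) (Complex.exp (ξ * Complex.I)) = Complex.exp (-(ξ * Complex.I)) := by
    rw [← Complex.exp_conj]; simp
  generalize hx : Complex.exp (η * Complex.I) = x at *
  generalize hxc : Complex.exp (-(η * Complex.I)) = x' at *
  generalize hy : Complex.exp (ξ * Complex.I) = y at *
  generalize hyc : Complex.exp (-(ξ * Complex.I)) = y' at *
  have hD : diagonal ![x', y', x, y] * diagonal ![x, y, x', y'] = 1 := by
    rw [Matrix.diagonal_mul_diagonal, ← Matrix.diagonal_one]
    congr 1
    ext i
    fin_cases i <;> simp [hη, hξ, mul_comm x', mul_comm y']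
  have hDz : diagonal (fun i => z (σ i)) =
      diagonal ![x, y, x', y'] * diagonal ![x, y, x', y'] := by
    rw [Matrix.diagonal_mul_diagonal]
    congr 1
    ext i
    fin_cases i
    · simp [hθ']
    · simp [hτ']
    · simp only [Fin.reduceFinMk, Matrix.cons_val]
      rw [← hθ'] at h02
      linear_combination (x' * x') * h02 - z (σ 2) * (x * x' + 1) * hη
    · simp only [Fin.reduceFinMk, Matrix.cons_val]
      rw [← hτ'] at h13
      linear_combination (y' * y') * h13 - z (σ 3) * (y * y' + 1) * hξ
  have hDu : diagonal ![x', y', x, y] ∈ Matrix.specialUnitaryGroup (Fin 4) ℂ := by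
    rw [Matrix.mem_specialUnitaryGroup_iff, Matrix.mem_unitaryGroup_iff]
    constructor
    · rw [← hD, Matrix.star_eq_conjTranspose, Matrix.diagonal_conjTranspose]
      congr 2
      ext i
      fin_cases i <;> simp [hηc, hξc, hηc', hξc']
    · rw [Matrix.det_diagonal, Fin.prod_univ_four]
      simp
      linear_combination y * y' * hη + hξ
  have hLu := map_ofReal_mem_unitaryGroup hLo
  have hLsu : L.map Complex.ofRealHom ∈ Matrix.specialUnitaryGroup (Fin 4) ℂ := by
    refine Matrix.mem_specialUnitaryGroup_iff.2 ⟨hLu, ?_⟩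
    rw [← RingHom.mapMatrix_apply, ← RingHom.map_det, hLdet, map_one]
  -- `K = V L D⁻¹` is unitary, and `Kᵀ K = D⁻¹ D² D⁻¹ = 1` makes it complex orthogonal as well,
  -- hence real.
  obtain ⟨K, hK, hKV⟩ := exists_map_ofReal_eq
    (K := V * L.map Complex.ofRealHom * diagonal ![x', y', x, y])
    (mul_mem (mul_mem hV hLsu) hDu) (by
      have hLL := Matrix.mem_unitaryGroup_iff'.1 hLu
      rw [star_map_ofReal] at hLL
      calc _ = diagonal ![x', y', x, y] * ((L.map Complex.ofRealHom)ᵀ *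
            (Vᵀ * V * L.map Complex.ofRealHom)) * diagonal ![x', y', x, y] := by
            simp only [Matrix.transpose_mul, Matrix.diagonal_transpose, Matrix.mul_assoc]
        _ = (diagonal ![x', y', x, y] * diagonal ![x, y, x', y']) *
            (diagonal ![x, y, x', y'] * diagonal ![x', y', x, y]) := by
            rw [hPL, ← Matrix.mul_assoc (_ᵀ), hLL, Matrix.one_mul, hDz]
            simp only [Matrix.mul_assoc]
        _ = 1 := by rw [hD, mul_eq_one_comm.1 hD, Matrix.one_mul])
  refine ⟨K, hK, Lᵀ, ?_, η, ξ, ?_⟩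
  · rw [Matrix.mem_specialOrthogonalGroup_iff, Matrix.mem_orthogonalGroup_iff',
      Matrix.det_transpose, Matrix.transpose_transpose]
    exact ⟨(Matrix.mem_orthogonalGroup_iff _ _).1 hLo, hLdet⟩
  · have hLL := Matrix.mem_unitaryGroup_iff.1 hLu
    rw [star_map_ofReal] at hLL
    rw [hx, hxc, hy, hyc, hKV, Matrix.mul_assoc (V * _), hD, Matrix.mul_one,
      Matrix.mul_assoc, Matrix.transpose_map,
      hLL, Matrix.mul_one]

/-! ### The circuit and the don't-care gate in the magic basis. -/

theorem Rz_eq (θ : ℝ) : Rz θ =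
    diagonal ![Complex.exp (Complex.I * (θ / 2)), (Complex.exp (Complex.I * (θ / 2)))⁻¹] := by
  have h : (Complex.I * (θ / 2 : ℂ)) • sigmaZ =
      diagonal ![Complex.I * (θ / 2), -(Complex.I * (θ / 2))] := by
    ext i j
    fin_cases i <;> fin_cases j <;> simp [sigmaZ]
  rw [Rz, h, Matrix.exp_diagonal]
  congr 1
  ext i
  fin_cases i <;> simp [Pi.coe_exp, ← Complex.exp_eq_exp_ℂ, Complex.exp_neg]

theorem Rx_eq (θ : ℝ) : Rx θ = (1 / 2 : ℂ) •
    !![Complex.exp (Complex.I * (θ / 2)) + (Complex.exp (Complex.I * (θ / 2)))⁻¹,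
        Complex.exp (Complex.I * (θ / 2)) - (Complex.exp (Complex.I * (θ / 2)))⁻¹;
      Complex.exp (Complex.I * (θ / 2)) - (Complex.exp (Complex.I * (θ / 2)))⁻¹,
        Complex.exp (Complex.I * (θ / 2)) + (Complex.exp (Complex.I * (θ / 2)))⁻¹] := by
  -- The unnormalised Hadamard matrix, which conjugates `σ_z` to `σ_x`.
  let H : (Matrix (Fin 2) (Fin 2) ℂ)ˣ :=
    ⟨!![1, 1; 1, -1], (1 / 2 : ℂ) • !![1, 1; 1, -1], by
      ext i j
      fin_cases i <;> fin_cases j <;> simp [Matrix.mul_apply] <;> norm_num, by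
      ext i j
      fin_cases i <;> fin_cases j <;> simp [Matrix.mul_apply] <;> norm_num⟩
  have hH : (↑H : Matrix (Fin 2) (Fin 2) ℂ) = !![1, 1; 1, -1] := rfl
  have hH' : (↑H⁻¹ : Matrix (Fin 2) (Fin 2) ℂ) = (1 / 2 : ℂ) • !![1, 1; 1, -1] := rfl
  have h : (Complex.I * (θ / 2 : ℂ)) • sigmaX =
      H * ((Complex.I * (θ / 2 : ℂ)) • sigmaZ) * (↑H⁻¹ : Matrix (Fin 2) (Fin 2) ℂ) := by
    rw [hH, hH']
    ext i j
    fin_cases i <;> fin_cases j <;> simp [sigmaX, sigmaZ, Matrix.mul_apply] <;> ring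
  have hz := Rz_eq θ
  rw [Rz] at hz
  rw [Rx, h, Matrix.exp_units_conj, hz, hH, hH']
  ext i j
  fin_cases i <;> fin_cases j <;> simp [Matrix.mul_apply, Matrix.vecMul_diagonal] <;> ring

/-- The entangling part of the circuit is diagonal in the magic basis. -/
theorem magic_mul_diagonal (α β : ℝ) {x y : ℂ} (hx : x = Complex.exp (Complex.I * (α / 2)))
    (hy : y = Complex.exp (Complex.I * (β / 2))) :
    magic * diagonal ![x * y, x⁻¹ * y, x⁻¹ * y⁻¹, x * y⁻¹] =
      CNOT * (Rx α ⊗ₖ Rz β) * CNOT * magic := by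
  -- Conjugation by CNOT turns `σ_x ⊗ 1` and `1 ⊗ σ_z` into `σ_x ⊗ σ_x` and `σ_z ⊗ σ_z`. The magic
  -- vectors are joint eigenvectors of these, with signs giving the four exponents.
  rw [Rx_eq, Rz_eq, ← hx, ← hy]
  ext ⟨i, j⟩ k
  rw [Matrix.mul_diagonal]
  fin_cases i <;> fin_cases j <;> fin_cases k <;>
    simp [magic, CNOT, Matrix.mul_apply, Fintype.sum_prod_type, Prod.ext_iff] <;> ring

/-- The diagonal gate with entry `e` at `|00⟩`, `|11⟩` and `e⁻¹` at `|01⟩`, `|10⟩`. -/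
def parityPhase (e : ℂ) : Op := diagonal fun p => if p.1 = p.2 then e else e⁻¹

/-- The first two magic vectors are supported on even parity, the last two on odd parity. -/
theorem magic_mul_diagonal_eq_parityPhase (e : ℂ) :
    magic * diagonal ![e, e, e⁻¹, e⁻¹] = parityPhase e * magic := by
  ext ⟨i, j⟩ k
  rw [parityPhase, Matrix.mul_diagonal, Matrix.diagonal_mul]
  fin_cases i <;> fin_cases j <;> fin_cases k <;> simp [magic, mul_comm]

theorem parityPhase_mem_unitaryGroup {e : ℂ} (he : ‖e‖ = 1) :
    parityPhase e ∈ Matrix.unitaryGroup Idx ℂ := by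
  have h0 : e ≠ 0 := fun h => by simp [h] at he
  have hc : (starRingEnd ℂ) e = e⁻¹ := (Complex.inv_eq_conj he).symm
  rw [Matrix.mem_unitaryGroup_iff, Matrix.star_eq_conjTranspose, parityPhase,
    Matrix.diagonal_conjTranspose, Matrix.diagonal_mul_diagonal, ← Matrix.diagonal_one]
  congr 1
  ext p
  by_cases hp : p.1 = p.2 <;> simp [hp, hc, h0]

/-- Diagonal operators preserve the subspaces spanned by computational basis vectors. -/
theorem IsCBDecomposition.preserves_diagonal {ι : Type*} {E : ι → Submodule ℂ StateSpace}
    (hE : IsCBDecomposition E) (d : Idx → ℂ) : Preserves E (diagonal d) := by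
  intro i
  obtain ⟨S, hS⟩ := hE.spanned i
  change E i ≤ (E i).comap (Matrix.toEuclideanLin (diagonal d))
  conv_lhs => rw [hS]
  rw [Submodule.span_le]
  rintro _ ⟨p, hp, rfl⟩
  have : Matrix.toEuclideanLin (diagonal d) (ket p) = d p • ket p := by
    ext q
    simp [ket, Matrix.toLpLin_apply]
  change _ ∈ E i
  rw [this]
  exact (E i).smul_mem _ (hS ▸ Submodule.subset_span ⟨p, hp, rfl⟩)

/-! ### Tuning the phase and assembling the circuit. -/

/-- A phase on the first two rows, and its inverse on the other two, make the trace of `Vᵀ V`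
real. -/
theorem exists_phase_trace_real (U : Matrix (Fin 4) (Fin 4) ℂ) :
    ∃ e : ℂ, ‖e‖ = 1 ∧ (((diagonal ![e, e, e⁻¹, e⁻¹] * U)ᵀ *
      (diagonal ![e, e, e⁻¹, e⁻¹] * U)).trace).im = 0 := by
  set p := ∑ j, (U 0 j ^ 2 + U 1 j ^ 2) with hp
  set q := ∑ j, (U 2 j ^ 2 + U 3 j ^ 2) with hq
  -- With `e = exp (it/2)` the trace is `exp (it) p + exp (-it) q`, whose imaginary part is this
  -- combination of `cos t` and `sin t`. It vanishes at the argument of `w`.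
  obtain ⟨t, ht⟩ : ∃ t : ℝ, (p.im + q.im) * Real.cos t + (p.re - q.re) * Real.sin t = 0 := by
    set w : ℂ := ⟨p.re - q.re, -(p.im + q.im)⟩
    refine ⟨w.arg, ?_⟩
    have h1 : p.re - q.re = ‖w‖ * Real.cos w.arg := (Complex.norm_mul_cos_arg w).symm
    have h2 : -(p.im + q.im) = ‖w‖ * Real.sin w.arg := (Complex.norm_mul_sin_arg w).symm
    linear_combination Real.sin w.arg * h1 - Real.cos w.arg * h2
  refine ⟨Complex.exp ((t / 2 : ℝ) * Complex.I), Complex.norm_exp_ofReal_mul_I _, ?_⟩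
  set e := Complex.exp ((t / 2 : ℝ) * Complex.I) with he
  have he2 : e ^ 2 = Complex.exp (t * Complex.I) := by
    rw [he, ← Complex.exp_nat_mul]; congr 1; push_cast; ring
  have he2' : e⁻¹ ^ 2 = Complex.exp ((-t : ℝ) * Complex.I) := by
    rw [inv_pow, he2, ← Complex.exp_neg]; congr 1; push_cast; ring
  have htr : ((diagonal ![e, e, e⁻¹, e⁻¹] * U)ᵀ *
      (diagonal ![e, e, e⁻¹, e⁻¹] * U)).trace = e ^ 2 * p + e⁻¹ ^ 2 * q := by
    simp only [Matrix.trace, Matrix.diag_apply, Matrix.mul_apply (M := _ᵀ),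
      Matrix.transpose_apply, Matrix.diagonal_mul, hp, hq, Finset.mul_sum]
    rw [← Finset.sum_add_distrib]
    refine Finset.sum_congr rfl fun j _ => ?_
    rw [Fin.sum_univ_four]
    simp
    ring
  rw [htr, he2, he2', Complex.add_im, Complex.mul_im, Complex.mul_im,
    Complex.exp_ofReal_mul_I_re, Complex.exp_ofReal_mul_I_im, Complex.exp_ofReal_mul_I_re,
    Complex.exp_ofReal_mul_I_im, Real.cos_neg, Real.sin_neg]
  linear_combination ht

/-- The magic basis change carries `U(4)` to itself. -/
theorem magic_conj_mem_unitaryGroup {u : Op} (hu : u ∈ Matrix.unitaryGroup Idx ℂ) :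
    ((1 / 2 : ℂ) • magicᴴ) * u * magic ∈ Matrix.unitaryGroup (Fin 4) ℂ := by
  rw [Matrix.mem_unitaryGroup_iff', Matrix.star_eq_conjTranspose]
  have hs : (((1 / 2 : ℂ) • magicᴴ) * u * magic)ᴴ = ((1 / 2 : ℂ) • magicᴴ) * (star u * magic) := by
    simp [Matrix.conjTranspose_mul, Matrix.star_eq_conjTranspose]
  calc _ = ((1 / 2 : ℂ) • magicᴴ) * (star u * (magic * ((1 / 2 : ℂ) • magicᴴ)) * u) * magic := by
        rw [hs]; simp only [Matrix.mul_assoc]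
    _ = 1 := by
        rw [magic_mul_conjTranspose, Matrix.mul_one, Matrix.mem_unitaryGroup_iff'.1 hu,
          Matrix.mul_one, conjTranspose_mul_magic]

theorem exists_phase_det_eq_one {u : Op} (hu : u ∈ Matrix.unitaryGroup Idx ℂ) :
    ∃ φ : ℝ, Complex.exp (φ * Complex.I) • u ∈ Matrix.specialUnitaryGroup Idx ℂ := by
  obtain ⟨θ, hθ⟩ := (Complex.norm_eq_one_iff u.det).1 (by
    have := Matrix.det_of_mem_unitary hu
    exact CStarRing.norm_of_mem_unitary this)
  -- A scalar enters the `4 × 4` determinant to the fourth power.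
  refine ⟨-θ / 4, Matrix.mem_specialUnitaryGroup_iff.2 ⟨?_, ?_⟩⟩
  · rw [Matrix.mem_unitaryGroup_iff, star_smul, smul_mul_smul_comm,
      Matrix.mem_unitaryGroup_iff.1 hu]
    have : Complex.exp ((-θ / 4 : ℝ) * Complex.I) * star (Complex.exp ((-θ / 4 : ℝ) * Complex.I))
        = 1 := by
      rw [Complex.star_def, Complex.mul_conj', Complex.norm_exp_ofReal_mul_I]
      simp
    rw [this, one_smul]
  · rw [Matrix.det_smul, ← hθ, ← Complex.exp_nat_mul, ← Complex.exp_add, Complex.exp_eq_one_iff]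
    refine ⟨0, ?_⟩
    simp
    ring

/-- Up to a phase and a gate `parityPhase e`, every two-qubit operator is computed by the
circuit. -/
theorem exists_twoCnotCircuit_eq {u : Op} (hu : u ∈ Matrix.unitaryGroup Idx ℂ) :
    ∃ (s : Setting) (φ : ℝ) (e : ℂ), ‖e‖ = 1 ∧
      twoCnotCircuit s = Complex.exp (φ * Complex.I) • (parityPhase e * u) := by
  obtain ⟨φ, hφ⟩ := exists_phase_det_eq_one hu
  obtain ⟨hw, hdet⟩ := Matrix.mem_specialUnitaryGroup_iff.1 hφ
  set w := Complex.exp (φ * Complex.I) • u with hwdef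
  set N := (1 / 2 : ℂ) • magicᴴ with hN
  have hMN : magic * N = 1 := magic_mul_conjTranspose
  have hNM : N * magic = 1 := conjTranspose_mul_magic
  obtain ⟨e, he, ht⟩ := exists_phase_trace_real (N * w * magic)
  have he0 : e ≠ 0 := fun h => by simp [h] at he
  have hc : (starRingEnd ℂ) e = e⁻¹ := (Complex.inv_eq_conj he).symm
  have hmem : diagonal ![e, e, e⁻¹, e⁻¹] * (N * w * magic) ∈
      Matrix.specialUnitaryGroup (Fin 4) ℂ := by
    refine mul_mem (Matrix.mem_specialUnitaryGroup_iff.2 ⟨?_, ?_⟩)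
      (Matrix.mem_specialUnitaryGroup_iff.2 ⟨magic_conj_mem_unitaryGroup hw, ?_⟩)
    · rw [Matrix.mem_unitaryGroup_iff, Matrix.star_eq_conjTranspose,
        Matrix.diagonal_conjTranspose, Matrix.diagonal_mul_diagonal, ← Matrix.diagonal_one]
      congr 1
      ext i
      fin_cases i <;> simp [hc, he0]
    · rw [Matrix.det_diagonal, Fin.prod_univ_four]
      simp [he0]
    · rw [Matrix.det_conj_of_mul_eq_one hNM hMN, hdet]
  obtain ⟨K, hK, L, hL, η, ξ, hKL⟩ := exists_canonical_decomposition hmem ht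
  obtain ⟨c, d, hcd⟩ := isLocal_of_mem_specialOrthogonalGroup hK
  obtain ⟨a, b, hab⟩ := isLocal_of_mem_specialOrthogonalGroup hL
  -- The angles solve `(α + β) / 2 = η` and `(β - α) / 2 = ξ`, matching the diagonal in
  -- `magic_mul_diagonal`.
  refine ⟨⟨a, b, c, d, η - ξ, η + ξ⟩, φ, e, he, ?_⟩
  have hmid := magic_mul_diagonal (η - ξ) (η + ξ) rfl rfl
  have hD :
      ![Complex.exp (Complex.I * ((η - ξ : ℝ) / 2)) * Complex.exp (Complex.I * ((η + ξ : ℝ) / 2)),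
        (Complex.exp (Complex.I * ((η - ξ : ℝ) / 2)))⁻¹ *
          Complex.exp (Complex.I * ((η + ξ : ℝ) / 2)),
        (Complex.exp (Complex.I * ((η - ξ : ℝ) / 2)))⁻¹ *
          (Complex.exp (Complex.I * ((η + ξ : ℝ) / 2)))⁻¹,
        Complex.exp (Complex.I * ((η - ξ : ℝ) / 2)) *
          (Complex.exp (Complex.I * ((η + ξ : ℝ) / 2)))⁻¹] =
      ![Complex.exp (η * Complex.I), Complex.exp (ξ * Complex.I),
          Complex.exp (-(η * Complex.I)), Complex.exp (-(ξ * Complex.I))] := by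
    simp only [← Complex.exp_neg, ← Complex.exp_add]
    push_cast
    ring_nf
  rw [hD] at hmid
  calc twoCnotCircuit ⟨a, b, c, d, η - ξ, η + ξ⟩
      = ((c : Matrix (Fin 2) (Fin 2) ℂ) ⊗ₖ (d : Matrix (Fin 2) (Fin 2) ℂ)) *
        (CNOT * (Rx (η - ξ) ⊗ₖ Rz (η + ξ)) * CNOT) *
        (((a : Matrix (Fin 2) (Fin 2) ℂ) ⊗ₖ (b : Matrix (Fin 2) (Fin 2) ℂ)) * (magic * N)) := by
        rw [hMN, Matrix.mul_one, twoCnotCircuit]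
        simp only [Matrix.mul_assoc]
    _ = magic * (diagonal ![e, e, e⁻¹, e⁻¹] * (N * w * magic)) * N := by
        rw [← Matrix.mul_assoc (_ ⊗ₖ _) magic N, ← hab, hKL]
        simp only [← Matrix.mul_assoc]
        rw [hcd]
        simp only [Matrix.mul_assoc] at hmid ⊢
        rw [← Matrix.mul_assoc magic (diagonal _), hmid]
        simp only [Matrix.mul_assoc]
    _ = parityPhase e * ((magic * N) * w * (magic * N)) := by
        rw [← Matrix.mul_assoc, magic_mul_diagonal_eq_parityPhase]
        simp only [Matrix.mul_assoc]
    _ = Complex.exp (φ * Complex.I) • (parityPhase e * u) := by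
        rw [hMN, Matrix.one_mul, Matrix.mul_one, hwdef, Matrix.mul_smul]

end TwoQubit

end

theorem mainTheorem1 {ι : Type*} (E : ι → Submodule ℂ TwoQubit.StateSpace)
    (hE : TwoQubit.IsCBDecomposition E) :
    TwoQubit.IsUniversalUpTo TwoQubit.twoCnotCircuit E := by
  intro u hu
  obtain ⟨s, φ, e, he, h⟩ := TwoQubit.exists_twoCnotCircuit_eq hu
  exact ⟨s, _, ⟨φ, h⟩, _, TwoQubit.parityPhase_mem_unitaryGroup he,
    hE.preserves_diagonal _, rfl⟩
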